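/- Let $(X,d)$ be a compact metric space, let $1\le p<\infty$, and let $\mu$ be a Borel probability measure on $X$. Write $\mathcal{P}(X)$ for the set of Borel probability measures on $X$ and $\mathrm{K}(X)$ for the set of non-empty compact subsets of $X$. For $\nu\in\mathcal{P}(X)$ let \[ F_p(\nu)=\underset{x\in X}{\arg\min}\int_X d^p(x,y)\,d\nu(y)\in\mathrm{K}(X) \] be the Fréchet $p$-mean of $\nu$, and let $H(\nu\,|\,\mu)=\int_X\log\frac{d\nu}{d\mu}\,d\nu$ if $\nu\ll\mu$ and $H(\nu\,|\,\mu)=\infty$ otherwise. For $C,C'\in\mathrm{K}(X)$ let $\rho(C,C')=\max_{x\in C}\min_{x'\in C'}d(x,x')$, and let $\tau_H^+$ be the topology on $\mathrm{K}(X)$ in which a net $(C_\alpha)$ converges to $C$ if and only if $\rho(C_\alpha,C)\to0$. Let $Y_1,Y_2,\dots$ be i.i.d. random elements of $X$ with law $\mu$, defined on a probability space $(\Omega,\mathcal{F},\mathbb{P})$, and let $\bar\mu_n=\frac1n\sum_{i=1}^n\delta_{Y_i}$ for $n\ge1$. Then the function $I_{p,\mu}:(\mathrm{K}(X),\tau_H^+)\to[0,\infty]$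 defined by \[ I_{p,\mu}(C)=\inf\{H(\nu\,|\,\mu):\nu\in\mathcal{P}(X),\ F_p(\nu)\supseteq C\}\qquad(\inf\emptyset=\infty) \] has compact sublevel sets $\{C\in\mathrm{K}(X): I_{p,\mu}(C)\le\alpha\}$, and for every Borel set $A$ of $(\mathrm{K}(X),\tau_H^+)$, with closure $\bar A$ in $\tau_H^+$, \[ \limsup_{n\to\infty}\frac1n\log\mathbb{P}\{F_p(\bar\mu_n)\in A\}\le-\inf\{I_{p,\mu}(C):C\in\bar A\}\qquad(\log 0=-\infty). \] Consequently, for every $\varepsilon>0$ there exist constants $c_1,c_2>0$, depending only on $(X,d)$, $\mu$, $p$ and $\varepsilon$, such that $\mathbb{P}\{\rho(F_p(\bar\mu_n),F_p(\mu))\ge\varepsilon\}\le c_1e^{-c_2n}$ for all $n\ge1$. -/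

import Mathlib

open MeasureTheory ProbabilityTheory Filter Topology Set
open scoped ENNReal

namespace FrechetLDP

/-- The set `K(X)` of non-empty compact subsets of `X`. This is a synonym of Mathlib's
`NonemptyCompacts X`, made so as not to inherit its (two-sided) Hausdorff topology: below it is
given the Hausdorff upper topology. -/
def HyperK (X : Type*) [TopologicalSpace X] : Type _ := TopologicalSpace.NonemptyCompacts X

instance (X : Type*) [TopologicalSpace X] : SetLike (HyperK X) X :=
  inferInstanceAs (SetLike (TopologicalSpace.NonemptyCompacts X) X)

section Hyperspace

variable {X : Type*} [MetricSpace X]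

theorem HyperK.isCompact (C : HyperK X) : IsCompact (C : Set X) :=
  TopologicalSpace.NonemptyCompacts.isCompact C

theorem HyperK.nonempty (C : HyperK X) : (C : Set X).Nonempty :=
  TopologicalSpace.NonemptyCompacts.nonempty C

/-- The one-sided Hausdorff distance `ρ(C, C') = max_{x ∈ C} min_{x' ∈ C'} d(x, x')`.
The extrema are attained because `C`, `C'` are compact and non-empty, so the supremum and the
infimum (in `Metric.infDist`) are a maximum and a minimum. -/
noncomputable def rho (C C' : HyperK X) : ℝ :=
  sSup ((fun x => Metric.infDist x (C' : Set X)) '' (C : Set X))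

theorem infDist_le_rho {C C' : HyperK X} {x : X} (hx : x ∈ (C : Set X)) :
    Metric.infDist x (C' : Set X) ≤ rho C C' :=
  le_csSup ((C.isCompact.image (Metric.continuous_infDist_pt _)).bddAbove)
    (mem_image_of_mem _ hx)

theorem rho_nonneg (C C' : HyperK X) : 0 ≤ rho C C' := by
  obtain ⟨x, hx⟩ := C.nonempty
  exact Metric.infDist_nonneg.trans (infDist_le_rho hx)

theorem rho_self (C : HyperK X) : rho C C = 0 := by
  refine le_antisymm (csSup_le (C.nonempty.image _) ?_) (rho_nonneg C C)
  rintro _ ⟨x, hx, rfl⟩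
  exact (Metric.infDist_zero_of_mem hx).le

theorem rho_triangle (C C' C'' : HyperK X) : rho C C'' ≤ rho C C' + rho C' C'' := by
  refine csSup_le (C.nonempty.image _) ?_
  rintro _ ⟨x, hx, rfl⟩
  obtain ⟨y, hy, hxy⟩ := C'.isCompact.exists_infDist_eq_dist C'.nonempty x
  have h1 : Metric.infDist x (C' : Set X) ≤ rho C C' := infDist_le_rho hx
  have h2 : Metric.infDist y (C'' : Set X) ≤ rho C' C'' := infDist_le_rho hy
  have h3 : Metric.infDist x (C'' : Set X) ≤ Metric.infDist y (C'' : Set X) + dist x y :=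
    Metric.infDist_le_infDist_add_dist
  simp only
  linarith

/-- The Hausdorff upper topology `τ_H⁺` on `K(X)`: a set is open if and only if around each of its
points `C` it contains some ball `{C' : ρ(C', C) < ε}`. See `tendsto_nhds_iff_rho`. -/
instance hausdorffUpper : TopologicalSpace (HyperK X) where
  IsOpen U := ∀ C ∈ U, ∃ ε : ℝ, 0 < ε ∧ ∀ C' : HyperK X, rho C' C < ε → C' ∈ U
  isOpen_univ := fun _ _ => ⟨1, one_pos, fun _ _ => mem_univ _⟩
  isOpen_inter := by
    rintro U V hU hV C ⟨hCU, hCV⟩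
    obtain ⟨a, ha, hU⟩ := hU C hCU
    obtain ⟨b, hb, hV⟩ := hV C hCV
    exact ⟨min a b, lt_min ha hb, fun C' h =>
      ⟨hU C' (h.trans_le (min_le_left _ _)), hV C' (h.trans_le (min_le_right _ _))⟩⟩
  isOpen_sUnion := by
    rintro S hS C ⟨U, hUS, hCU⟩
    obtain ⟨a, ha, hU⟩ := hS U hUS C hCU
    exact ⟨a, ha, fun C' h => ⟨U, hUS, hU C' h⟩⟩

theorem isOpen_rho_ball (C : HyperK X) (ε : ℝ) : IsOpen {C' : HyperK X | rho C' C < ε} := by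
  intro C' hC'
  refine ⟨ε - rho C' C, sub_pos.2 hC', fun C'' h => ?_⟩
  have := rho_triangle C'' C' C
  change rho C'' C < ε
  linarith

/-- Convergence `C_α → C` in `τ_H⁺` means `ρ(C_α, C) → 0`, for nets as well as for sequences.
This property characterizes the topology. -/
theorem tendsto_nhds_iff_rho {ι : Type*} {l : Filter ι} {u : ι → HyperK X} {C : HyperK X} :
    Tendsto u l (𝓝 C) ↔ Tendsto (fun i => rho (u i) C) l (𝓝 0) := by
  constructor
  · intro h
    refine tendsto_order.2 ⟨fun a ha => Eventually.of_forall fun i =>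
      ha.trans_le (rho_nonneg _ _), fun a ha => ?_⟩
    exact h.eventually ((isOpen_rho_ball C a).mem_nhds (by simpa [rho_self] using ha))
  · intro h
    refine tendsto_nhds.2 fun U hU hCU => ?_
    obtain ⟨a, ha, hU⟩ := hU C hCU
    filter_upwards [h.eventually (gt_mem_nhds ha)] with i hi
    exact hU _ hi

end Hyperspace

section Frechet

variable {X : Type*} [MetricSpace X] [MeasurableSpace X]

/-- `f_p(ν, x) = ∫ d(x, y)^p dν(y)`. -/
noncomputable def frechetFun (p : ℝ) (ν : Measure X) (x : X) : ℝ :=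
  ∫ y, dist x y ^ p ∂ν

/-- The Fréchet `p`-mean of `ν` as a set: all the global minimizers of `f_p(ν, ·)`. -/
def frechetSet (p : ℝ) (ν : Measure X) : Set X :=
  {x | ∀ x', frechetFun p ν x ≤ frechetFun p ν x'}

variable [BorelSpace X] [CompactSpace X]

theorem continuous_frechetFun {p : ℝ} (hp : 1 ≤ p) (ν : Measure X) [IsFiniteMeasure ν] :
    Continuous (frechetFun p ν) := by
  have hf : Continuous (Function.uncurry fun x y : X => dist x y ^ p) :=
    continuous_dist.rpow_const fun _ => Or.inr (zero_le_one.trans hp)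
  have h := continuous_parametric_integral_of_continuous (μ := ν) hf (isCompact_univ (X := X))
  simp only [Measure.restrict_univ] at h
  exact h

/-- On a compact space, the Fréchet `p`-mean `F_p(ν)` of a probability measure, as an element of
`K(X)`. -/
def frechetMean (p : ℝ) (hp : 1 ≤ p) (ν : ProbabilityMeasure X) : HyperK X :=
  { carrier := frechetSet p (ν : Measure X)
    isCompact' := by
      have h : frechetSet p (ν : Measure X) =
          ⋂ x', {x | frechetFun p (ν : Measure X) x ≤ frechetFun p (ν : Measure X) x'} := by
        ext x; simp [frechetSet]
      rw [h]
      exact (isClosed_iInter fun x' =>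
        isClosed_le (continuous_frechetFun hp _) continuous_const).isCompact
    nonempty' := by
      have : Nonempty X := ν.nonempty
      obtain ⟨x, -, hx⟩ := isCompact_univ.exists_isMinOn univ_nonempty
        (continuous_frechetFun hp (ν : Measure X)).continuousOn
      exact ⟨x, fun x' => hx (mem_univ x')⟩ }

/-- `I_{p,μ}(C) = inf {H(ν | μ) : ν ∈ P(X), F_p(ν) ⊇ C}`, an element of `[0, ∞]` (the infimum of the
empty set is `∞`). For probability measures Mathlib's Kullback–Leibler divergence `klDiv ν μ` is the
relative entropy `H(ν | μ)`. -/
noncomputable def rateFun (p : ℝ) (hp : 1 ≤ p) (μ : ProbabilityMeasure X) (C : HyperK X) : ℝ≥0∞ :=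
  ⨅ (ν : ProbabilityMeasure X) (_ : (C : Set X) ⊆ (frechetMean p hp ν : Set X)),
    InformationTheory.klDiv (ν : Measure X) (μ : Measure X)

end Frechet

/-- The empirical measure `(1/n) ∑ δ_{y_i}` of the first `n` terms `y 0, …, y (n - 1)`, `n ≥ 1`. -/
noncomputable def empirical {X : Type*} [MeasurableSpace X] (n : ℕ+) (y : ℕ → X) :
    ProbabilityMeasure X :=
  ⟨((n : ℕ) : ℝ≥0∞)⁻¹ • ∑ i ∈ Finset.range n, Measure.dirac (y i), ⟨by
    simp [ENNReal.inv_mul_cancel]⟩⟩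

/-- `Y 0, Y 1, …` are i.i.d. random elements of `X` with law `μ`, on the probability space
`(Ω, P)`. -/
structure IsIIDSample {Ω X : Type*} [MeasurableSpace Ω] [MeasurableSpace X]
    (P : Measure Ω) (μ : ProbabilityMeasure X) (Y : ℕ → Ω → X) : Prop where
  measurable : ∀ i, Measurable (Y i)
  indep : iIndepFun Y P
  law : ∀ i, P.map (Y i) = (μ : Measure X)

end FrechetLDP

open FrechetLDP

/-! By convex duality, $H(\nu|\mu)$ is the supremum over $f\in C(X)$ of $\int f\,d\nu-\int e^f
d\mu+1$ (`entropyDual_le_klDiv`, `klDiv_le_of_forall_continuous`). Each functional is weakly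
continuous in $\nu$, so $H(\cdot|\mu)$ is lower semicontinuous, and Chernoff's bound gives
$\bar\mu_n$ probability at most $e^{-cn}$ of lying where the functional is at least $c$. As
$\mathcal P(X)$ is compact, finitely many such half-spaces cover a closed set on which $H>c$; this
is Sanov's upper bound.

The bound passes to Fréchet means because $F_p$ is continuous into $\tau_H^+$
(`continuous_frechetMean`): the preimage of $\bar A$ is closed, and there $H(\nu|\mu)\ge
I_{p,\mu}(F_p(\nu))$. For concentration, $H$ has a positive minimum on
$\{\rho(F_p(\nu),F_p(\mu))\ge\varepsilon\}$ if this closed set is non-empty, since $H$ vanishes only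
at $\mu$. A finite sublevel set of $I_{p,\mu}$ consists of the non-empty compact subsets of the
members of $F_p(\{H\le\alpha\})$, and passing to subsets preserves compactness in $\tau_H^+$. -/

namespace FrechetLDP

/-! ### Dual formula and lower semicontinuity of relative entropy -/

section Entropy

open InformationTheory

/-- Young's inequality for the conjugate pair `klFun` and `t ↦ exp t - 1`. -/
theorem mul_sub_exp_add_one_le_klFun {g : ℝ} (hg : 0 ≤ g) (t : ℝ) :
    g * t - Real.exp t + 1 ≤ klFun g := by
  rw [klFun_apply]
  rcases hg.eq_or_lt with rfl | hg
  · simp [(Real.exp_pos t).le]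
  -- Equality holds at `t = log g`, which is why `log g` is the optimal test function.
  · have h := Real.add_one_le_exp (t - Real.log g)
    rw [Real.exp_sub, Real.exp_log hg, le_div_iff₀ hg] at h
    nlinarith

/-- The clipped logarithm of `g` keeps Young's functional nonnegative. -/
theorem mul_log_clip_nonneg {a b g : ℝ} (ha : 0 < a) (ha1 : a ≤ 1) (hb : 1 ≤ b) :
    0 ≤ g * Real.log (max a (min b g)) - max a (min b g) + 1 := by
  set m := max a (min b g) with hm
  have hm0 : 0 < m := lt_max_of_lt_left ha
  have hkl : 0 ≤ m * Real.log m + 1 - m := klFun_nonneg hm0.le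
  -- The clipping interval `[a, b]` contains 1, so `g - m` and `log m` never have opposite signs.
  have key : 0 ≤ (g - m) * Real.log m := by
    rcases le_total 1 g with h | h
    · have h1 : 1 ≤ m := le_max_of_le_right (le_min hb h)
      have h2 : m ≤ g := max_le (ha1.trans h) (min_le_right _ _)
      exact mul_nonneg (sub_nonneg.2 h2) (Real.log_nonneg h1)
    · have h1 : m ≤ 1 := max_le ha1 ((min_le_right _ _).trans h)
      have h2 : g ≤ m := by
        rw [hm, min_eq_right (h.trans hb)]
        exact le_max_right _ _
      exact mul_nonneg_of_nonpos_of_nonpos (sub_nonpos.2 h2) (Real.log_nonpos hm0.le h1)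
  linarith

theorem tendsto_clip (g : ℝ) (hg : 0 ≤ g) :
    Tendsto (fun k : ℕ => max (1 / ((k : ℝ) + 1)) (min ((k : ℝ) + 1) g)) atTop (𝓝 g) := by
  have h1 : Tendsto (fun k : ℕ => (1 : ℝ) / ((k : ℝ) + 1)) atTop (𝓝 0) :=
    tendsto_one_div_add_atTop_nhds_zero_nat
  have h2 : Tendsto (fun k : ℕ => min ((k : ℝ) + 1) g) atTop (𝓝 g) := by
    refine tendsto_const_nhds.congr' ?_
    filter_upwards [eventually_ge_atTop ⌈g⌉₊] with k hk
    have : g ≤ k := (Nat.le_ceil g).trans (by exact_mod_cast hk)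
    rw [min_eq_right (by linarith)]
  simpa [max_eq_right hg] using h1.max h2

theorem tendsto_mul_log_clip {g : ℝ} (hg : 0 ≤ g) :
    Tendsto (fun k : ℕ => g * Real.log (max (1 / ((k : ℝ) + 1)) (min ((k : ℝ) + 1) g))
      - max (1 / ((k : ℝ) + 1)) (min ((k : ℝ) + 1) g) + 1) atTop (𝓝 (klFun g)) := by
  have hm := tendsto_clip g hg
  have hlog : Tendsto
      (fun k : ℕ => g * Real.log (max (1 / ((k : ℝ) + 1)) (min ((k : ℝ) + 1) g)))
      atTop (𝓝 (g * Real.log g)) := by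
    rcases hg.eq_or_lt with rfl | hg
    · simp
    · exact ((Real.continuousAt_log hg.ne').tendsto.comp hm).const_mul g
  have h := (hlog.sub hm).add_const 1
  rwa [show g * Real.log g - g + 1 = klFun g by rw [klFun_apply]; ring] at h

variable {X : Type*} [MeasurableSpace X]

/-- The concave functional of `f` whose supremum is the relative entropy of `ν` with respect to
`μ`. -/
noncomputable def entropyDual (ν μ : Measure X) (f : X → ℝ) : ℝ :=
  ∫ x, f x ∂ν - ∫ x, Real.exp (f x) ∂μ + 1

theorem integrable_of_abs_le {ν : Measure X} [IsFiniteMeasure ν] {f : X → ℝ} {M : ℝ}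
    (hf : Measurable f) (hM : ∀ x, |f x| ≤ M) : Integrable f ν :=
  Integrable.of_bound hf.aestronglyMeasurable M (ae_of_all _ hM)

theorem integrable_exp_of_abs_le {ν : Measure X} [IsFiniteMeasure ν] {f : X → ℝ} {M : ℝ}
    (hf : Measurable f) (hM : ∀ x, |f x| ≤ M) : Integrable (fun x => Real.exp (f x)) ν :=
  integrable_of_abs_le (M := Real.exp M) (Real.measurable_exp.comp hf) fun x => by
    rw [Real.abs_exp]
    exact Real.exp_le_exp.2 ((le_abs_self _).trans (hM x))

variable {ν μ : Measure X} [IsProbabilityMeasure ν] [IsProbabilityMeasure μ]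

theorem integrable_rnDeriv_mul_sub_exp (h_ac : ν ≪ μ) {f : X → ℝ} {M : ℝ}
    (hf : Measurable f) (hM : ∀ x, |f x| ≤ M) :
    Integrable (fun x => (ν.rnDeriv μ x).toReal * f x - Real.exp (f x) + 1) μ := by
  have h1 : Integrable (fun x => (ν.rnDeriv μ x).toReal * f x) μ :=
    (integrable_rnDeriv_smul_iff h_ac).2 (integrable_of_abs_le hf hM)
  exact (h1.sub (integrable_exp_of_abs_le hf hM)).add (integrable_const 1)

theorem integral_rnDeriv_mul_sub_exp (h_ac : ν ≪ μ) {f : X → ℝ} {M : ℝ}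
    (hf : Measurable f) (hM : ∀ x, |f x| ≤ M) :
    ∫ x, ((ν.rnDeriv μ x).toReal * f x - Real.exp (f x) + 1) ∂μ = entropyDual ν μ f := by
  have h1 : Integrable (fun x => (ν.rnDeriv μ x).toReal * f x) μ :=
    (integrable_rnDeriv_smul_iff h_ac).2 (integrable_of_abs_le hf hM)
  have h2 := integrable_exp_of_abs_le (ν := μ) hf hM
  have h3 : ∫ x, ((ν.rnDeriv μ x).toReal * f x - Real.exp (f x) + 1) ∂μ =
      ∫ x, ((ν.rnDeriv μ x).toReal * f x - Real.exp (f x)) ∂μ + ∫ _, (1 : ℝ) ∂μ :=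
    integral_add (h1.sub h2) (integrable_const 1)
  rw [h3, integral_sub h1 h2, integral_toReal_rnDeriv_mul h_ac, entropyDual]
  simp

/-- Young's inequality at the density, integrated against `μ`. -/
theorem entropyDual_le_klDiv {f : X → ℝ} {M : ℝ} (hf : Measurable f) (hM : ∀ x, |f x| ≤ M) :
    ENNReal.ofReal (entropyDual ν μ f) ≤ klDiv ν μ := by
  by_cases h : klDiv ν μ = ∞
  · simp [h]
  have h' := klDiv_ne_top_iff.1 h
  rw [← ENNReal.ofReal_toReal h, toReal_klDiv_eq_integral_klFun h'.1,
    ← integral_rnDeriv_mul_sub_exp h'.1 hf hM]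
  refine ENNReal.ofReal_le_ofReal (integral_mono (integrable_rnDeriv_mul_sub_exp h'.1 hf hM)
    ((integrable_klFun_rnDeriv_iff h'.1).2 h'.2) fun x => ?_)
  exact mul_sub_exp_add_one_le_klFun ENNReal.toReal_nonneg _

/-- The relative entropy is bounded by the supremum of `entropyDual` over bounded measurable
functions. -/
theorem klDiv_le_of_forall_bounded {c : ℝ}
    (h : ∀ (f : X → ℝ) (M : ℝ), Measurable f → (∀ x, |f x| ≤ M) → entropyDual ν μ f ≤ c) :
    klDiv ν μ ≤ ENNReal.ofReal c := by
  have h_ac : ν ≪ μ := by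
    refine Measure.AbsolutelyContinuous.mk fun s hs hμs => ?_
    by_contra hνs
    have hpos : 0 < ν.real s := ENNReal.toReal_pos hνs (measure_ne_top _ _)
    -- If `μ s = 0 < ν s`, the test function `k · 1_s` has dual value `k ν(s)`, which is unbounded
    -- in `k`.
    obtain ⟨k, hk⟩ := exists_nat_gt (c / ν.real s)
    have hb := h (s.indicator fun _ => (k : ℝ)) k (measurable_const.indicator hs) fun x => by
      by_cases hx : x ∈ s <;> simp [hx]
    have h1 : ∫ x, Real.exp (s.indicator (fun _ => (k : ℝ)) x) ∂μ = 1 := by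
      have : (fun x => Real.exp (s.indicator (fun _ => (k : ℝ)) x)) =ᵐ[μ] fun _ => 1 := by
        filter_upwards [measure_eq_zero_iff_ae_notMem.1 hμs] with x hx
        simp [hx]
      rw [integral_congr_ae this]
      simp
    rw [entropyDual, h1, integral_indicator_const _ hs, smul_eq_mul] at hb
    rw [div_lt_iff₀ hpos] at hk
    linarith
  rw [klDiv_eq_lintegral_klFun_of_ac h_ac]
  -- The optimal test function, the log density, may be unbounded. Clipping the density to
  -- `[1/(k+1), k+1]` makes it admissible; the integrands stay nonnegative, so Fatou's lemma removes
  -- the clipping.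
  let m : ℕ → X → ℝ := fun k x =>
    max (1 / ((k : ℝ) + 1)) (min ((k : ℝ) + 1) (ν.rnDeriv μ x).toReal)
  have hm_meas : ∀ k, Measurable (m k) := fun k => by
    have := (Measure.measurable_rnDeriv ν μ).ennreal_toReal
    fun_prop
  have hk0 : ∀ k : ℕ, 0 < 1 / ((k : ℝ) + 1) := fun k => by positivity
  have hk1 : ∀ k : ℕ, 1 / ((k : ℝ) + 1) ≤ 1 := fun k => by
    rw [div_le_one (by positivity)]
    linarith [k.cast_nonneg (α := ℝ)]
  have hk2 : ∀ k : ℕ, (1 : ℝ) ≤ (k : ℝ) + 1 := fun k => by linarith [k.cast_nonneg (α := ℝ)]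
  have hm0 : ∀ k x, 0 < m k x := fun k x => lt_max_of_lt_left (hk0 k)
  have hlog_meas : ∀ k, Measurable fun x => Real.log (m k x) := fun k =>
    Real.measurable_log.comp (hm_meas k)
  have hlog_bdd : ∀ k x, |Real.log (m k x)| ≤ Real.log ((k : ℝ) + 1) := fun k x => by
    refine abs_le.2 ⟨?_, ?_⟩
    · rw [← Real.log_inv, ← one_div]
      exact Real.log_le_log (hk0 k) (le_max_left _ _)
    · exact Real.log_le_log (hm0 k x)
        (max_le ((hk1 k).trans (hk2 k)) (min_le_left _ _))
  let φ : ℕ → X → ℝ := fun k x => (ν.rnDeriv μ x).toReal * Real.log (m k x) - m k x + 1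
  have hφ_meas : ∀ k, Measurable (φ k) := fun k =>
    ((((Measure.measurable_rnDeriv ν μ).ennreal_toReal).mul (hlog_meas k)).sub
      (hm_meas k)).add_const 1
  have hφ_le : ∀ k, ∫⁻ x, ENNReal.ofReal (φ k x) ∂μ ≤ ENNReal.ofReal c := fun k => by
    have heq : φ k = fun x => (ν.rnDeriv μ x).toReal * Real.log (m k x)
        - Real.exp (Real.log (m k x)) + 1 := by
      ext x
      simp only [φ, Real.exp_log (hm0 k x)]
    have hint : Integrable (φ k) μ := by
      rw [heq]
      exact integrable_rnDeriv_mul_sub_exp h_ac (hlog_meas k) (hlog_bdd k)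
    rw [← ofReal_integral_eq_lintegral_ofReal hint (ae_of_all _ fun x =>
      mul_log_clip_nonneg (hk0 k) (hk1 k) (hk2 k)), heq,
      integral_rnDeriv_mul_sub_exp h_ac (hlog_meas k) (hlog_bdd k)]
    exact ENNReal.ofReal_le_ofReal (h _ _ (hlog_meas k) (hlog_bdd k))
  calc ∫⁻ x, ENNReal.ofReal (klFun (ν.rnDeriv μ x).toReal) ∂μ
      = ∫⁻ x, liminf (fun k => ENNReal.ofReal (φ k x)) atTop ∂μ := by
        refine lintegral_congr fun x => ?_
        exact ((ENNReal.continuous_ofReal.tendsto _).comp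
          (tendsto_mul_log_clip ENNReal.toReal_nonneg)).liminf_eq.symm
    _ ≤ liminf (fun k => ∫⁻ x, ENNReal.ofReal (φ k x) ∂μ) atTop :=
        lintegral_liminf_le fun k => (hφ_meas k).ennreal_ofReal
    _ ≤ ENNReal.ofReal c :=
        liminf_le_of_frequently_le' (Frequently.of_forall hφ_le)

variable [MetricSpace X] [CompactSpace X] [BorelSpace X]

/-- Continuous functions suffice in the dual description of the relative entropy. -/
theorem klDiv_le_of_forall_continuous {c : ℝ} (h : ∀ f : C(X, ℝ), entropyDual ν μ f ≤ c) :
    klDiv ν μ ≤ ENNReal.ofReal c := by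
  refine klDiv_le_of_forall_bounded fun f M hf hM => ?_
  refine le_of_forall_pos_le_add fun ε hε => ?_
  have hK : 0 < 1 + Real.exp M := by positivity
  -- Approximating in `L¹(ν + μ)` serves both integrals at once. The factor `1 + e^M` adds the
  -- Lipschitz constants of the identity (for `ν`) and of `exp` on `[-M, M]` (for `μ`).
  obtain ⟨g, hg, -⟩ := (integrable_of_abs_le (ν := ν + μ) hf
    hM).exists_boundedContinuous_integral_sub_le (div_pos hε hK)
  have hM0 : 0 ≤ M := by
    have : Nonempty X := nonempty_of_isProbabilityMeasure μ
    exact (abs_nonneg _).trans (hM (Classical.arbitrary X))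
  -- Clipping to `[-M, M]`, where `f` takes its values, does not increase the distance to `f`.
  let k : C(X, ℝ) := ⟨fun x => max (-M) (min M (g x)), by fun_prop⟩
  have hkM : ∀ x, |k x| ≤ M := fun x =>
    abs_le.2 ⟨le_max_left _ _, max_le (by linarith) (min_le_left _ _)⟩
  have hk_meas : Measurable k := k.continuous.measurable
  have hfk : ∀ x, |f x - k x| ≤ ‖f x - g x‖ := fun x => by
    have hx : max (-M) (min M (f x)) = f x := by
      rw [min_eq_right (abs_le.1 (hM x)).2, max_eq_right (abs_le.1 (hM x)).1]
    have h1 := abs_max_sub_max_le_max (-M) (min M (f x)) (-M) (min M (g x))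
    have h2 := abs_min_sub_min_le_max M (f x) M (g x)
    rw [hx, sub_self, abs_zero, max_eq_right (a := (0 : ℝ)) (abs_nonneg _)] at h1
    rw [sub_self, abs_zero, max_eq_right (a := (0 : ℝ)) (abs_nonneg _)] at h2
    exact h1.trans h2
  have hexp : ∀ x, Real.exp (k x) - Real.exp (f x) ≤ Real.exp M * |f x - k x| := fun x => by
    have h1 := Real.add_one_le_exp (f x - k x)
    rw [Real.exp_sub, le_div_iff₀ (Real.exp_pos _)] at h1
    have h2 : Real.exp (k x) ≤ Real.exp M := Real.exp_le_exp.2 ((le_abs_self _).trans (hkM x))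
    have h3 : k x - f x ≤ |f x - k x| := by rw [abs_sub_comm]; exact le_abs_self _
    have h4 : Real.exp (k x) * (k x - f x) ≤ Real.exp (k x) * |f x - k x| := by gcongr
    have h5 : Real.exp (k x) * |f x - k x| ≤ Real.exp M * |f x - k x| := by gcongr
    linarith
  have hint : ∀ (η : Measure X) [IsFiniteMeasure η], Integrable (fun x => |f x - k x|) η :=
    fun η _ => ((integrable_of_abs_le hf hM).sub (integrable_of_abs_le hk_meas hkM)).abs
  have hsum : ∫ x, |f x - k x| ∂ν + ∫ x, |f x - k x| ∂μ ≤ ε / (1 + Real.exp M) := by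
    rw [← integral_add_measure (hint ν) (hint μ)]
    refine (integral_mono (hint _) ?_ hfk).trans hg
    exact ((integrable_of_abs_le hf hM).sub (g.integrable _)).norm
  have hν : ∫ x, f x ∂ν - ∫ x, k x ∂ν ≤ ∫ x, |f x - k x| ∂ν := by
    rw [← integral_sub (integrable_of_abs_le hf hM) (integrable_of_abs_le hk_meas hkM)]
    exact (le_abs_self _).trans abs_integral_le_integral_abs
  have hμ : ∫ x, Real.exp (k x) ∂μ - ∫ x, Real.exp (f x) ∂μ
      ≤ Real.exp M * ∫ x, |f x - k x| ∂μ := by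
    rw [← integral_sub (integrable_exp_of_abs_le hk_meas hkM) (integrable_exp_of_abs_le hf hM),
      ← integral_const_mul]
    exact integral_mono ((integrable_exp_of_abs_le hk_meas hkM).sub
      (integrable_exp_of_abs_le hf hM)) ((hint μ).const_mul _) hexp
  have hν0 : 0 ≤ ∫ x, |f x - k x| ∂ν := integral_nonneg fun x => abs_nonneg _
  have hμ0 : 0 ≤ ∫ x, |f x - k x| ∂μ := integral_nonneg fun x => abs_nonneg _
  have hk := h k
  rw [le_div_iff₀ hK] at hsum
  rw [entropyDual] at hk ⊢
  nlinarith [Real.exp_pos M]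

theorem exists_continuous_lt_entropyDual {c : ℝ} (h : ENNReal.ofReal c < klDiv ν μ) :
    ∃ f : C(X, ℝ), c < entropyDual ν μ f := by
  by_contra! hc
  exact h.not_ge (klDiv_le_of_forall_continuous hc)

theorem continuous_entropyDual (μ : Measure X) (f : C(X, ℝ)) :
    Continuous fun ν : ProbabilityMeasure X => entropyDual (ν : Measure X) μ f :=
  ((ProbabilityMeasure.continuous_integral_continuousMap f).sub continuous_const).add
    continuous_const

/-- A test function that beats the level `y` at `ν` still beats it near `ν`. -/
theorem lowerSemicontinuous_klDiv (μ : ProbabilityMeasure X) :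
    LowerSemicontinuous fun ν : ProbabilityMeasure X => klDiv (ν : Measure X) (μ : Measure X) := by
  intro ν y hy
  have hy' : ENNReal.ofReal y.toReal = y := ENNReal.ofReal_toReal hy.ne_top
  obtain ⟨f, hf⟩ := exists_continuous_lt_entropyDual (c := y.toReal) (hy'.symm ▸ hy)
  filter_upwards [(continuous_entropyDual (μ : Measure X) f).continuousAt.eventually
    (lt_mem_nhds hf)] with ν' hν'
  calc y = ENNReal.ofReal y.toReal := hy'.symm
    _ < ENNReal.ofReal (entropyDual (ν' : Measure X) μ f) :=
        ENNReal.ofReal_lt_ofReal_iff_of_nonneg ENNReal.toReal_nonneg |>.2 hν'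
    _ ≤ _ := entropyDual_le_klDiv f.continuous.measurable fun x => f.norm_coe_le_norm x

end Entropy

/-! ### Sanov's upper bound -/

section Sanov

open InformationTheory

variable {X : Type*} [MetricSpace X] [CompactSpace X] [MeasurableSpace X] [BorelSpace X]

theorem integral_empirical (n : ℕ+) (y : ℕ → X) (f : C(X, ℝ)) :
    ∫ x, f x ∂(empirical n y : Measure X) = (n : ℝ)⁻¹ * ∑ i ∈ Finset.range n, f (y i) := by
  change ∫ x, f x ∂(((n : ℕ) : ℝ≥0∞)⁻¹ • ∑ i ∈ Finset.range n, Measure.dirac (y i)) = _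
  rw [integral_smul_measure, integral_finsetSum_measure fun i _ =>
    integrable_of_abs_le f.continuous.measurable fun x => f.norm_coe_le_norm x]
  simp

/-- Chernoff's bound for the half-space of measures `{ν | c ≤ entropyDual ν μ f}`. -/
theorem IsIIDSample.measureReal_le_entropyDual_le {Ω : Type*} [MeasurableSpace Ω] {P : Measure Ω}
    [IsProbabilityMeasure P] {μ : ProbabilityMeasure X} {Y : ℕ → Ω → X} (hY : IsIIDSample P μ Y)
    (f : C(X, ℝ)) (c : ℝ) (n : ℕ+) :
    P.real {ω | c ≤ entropyDual (empirical n fun i => Y i ω : Measure X) μ f}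
      ≤ Real.exp (-c * n) := by
  set L : ℝ := ∫ x, Real.exp (f x) ∂(μ : Measure X) with hL
  have hn : (0 : ℝ) < n := by exact_mod_cast n.pos
  let Z : ℕ → Ω → ℝ := fun i ω => f (Y i ω)
  have hZ : ∀ i, Measurable (Z i) := fun i => f.continuous.measurable.comp (hY.measurable i)
  have hind : iIndepFun Z P := hY.indep.comp (fun _ => f) fun _ => f.continuous.measurable
  have hmgf : ∀ i, mgf (Z i) P 1 = L := fun i => by
    have hexp : Measurable fun x => Real.exp (f x) :=
      Real.measurable_exp.comp f.continuous.measurable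
    rw [hL, ← hY.law i, integral_map (hY.measurable i).aemeasurable hexp.aestronglyMeasurable]
    simp [mgf, Z]
  have hS : mgf (∑ i ∈ Finset.range n, Z i) P 1 = L ^ (n : ℕ) := by
    rw [hind.mgf_sum hZ, Finset.prod_congr rfl fun i _ => hmgf i]
    simp
  have hSb : ∀ ω, |(∑ i ∈ Finset.range n, Z i) ω| ≤ n * ‖f‖ := fun ω => by
    rw [Finset.sum_apply]
    refine (Finset.abs_sum_le_sum_abs _ _).trans ?_
    refine (Finset.sum_le_sum fun i _ => f.norm_coe_le_norm (Y i ω)).trans ?_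
    simp
  have hSm : Measurable (∑ i ∈ Finset.range n, Z i) := by
    fun_prop
  have hchern := measure_ge_le_exp_mul_mgf (μ := P) (X := ∑ i ∈ Finset.range n, Z i) (t := 1)
    (n * (c + L - 1)) zero_le_one (by simpa using integrable_exp_of_abs_le hSm hSb)
  have hset : {ω | c ≤ entropyDual (empirical n fun i => Y i ω : Measure X) μ f}
      = {ω | n * (c + L - 1) ≤ (∑ i ∈ Finset.range n, Z i) ω} := by
    ext ω
    simp only [mem_ofPred_eq, entropyDual, integral_empirical, Finset.sum_apply, ← hL, Z]
    rw [← le_div_iff₀' hn, div_eq_inv_mul]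
    constructor <;> intro h <;> linarith
  have hL0 : 0 ≤ L := integral_nonneg fun x => (Real.exp_pos _).le
  -- This absorbs the moment generating function `L ^ n` into the `L - 1` of the threshold, leaving
  -- exactly `e^{-cn}`.
  have hLe : L ≤ Real.exp (L - 1) := by linarith [Real.add_one_le_exp (L - 1)]
  rw [hset]
  calc _ ≤ _ := hchern
    _ ≤ Real.exp (-1 * (n * (c + L - 1))) * Real.exp (L - 1) ^ (n : ℕ) := by
      rw [hS]
      gcongr
    _ = Real.exp (-c * n) := by
      rw [← Real.exp_nat_mul, ← Real.exp_add]
      congr 1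
      ring

/-- Sanov's upper bound for closed sets, in a non-asymptotic form: the constant `N` depends on the
closed set and on the level `c` only. -/
theorem exists_measureReal_empirical_mem_le (μ : ProbabilityMeasure X)
    {Γ : Set (ProbabilityMeasure X)} (hΓ : IsClosed Γ) {c : ℝ}
    (h : ∀ ν ∈ Γ, ENNReal.ofReal c < klDiv (ν : Measure X) (μ : Measure X)) :
    ∃ N : ℕ, 0 < N ∧ ∀ (Ω : Type*) [MeasurableSpace Ω] (P : Measure Ω) [IsProbabilityMeasure P]
      (Y : ℕ → Ω → X), IsIIDSample P μ Y → ∀ n : ℕ+,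
        P.real {ω | empirical n (fun i => Y i ω) ∈ Γ} ≤ N * Real.exp (-c * n) := by
  choose! f hf using fun ν hν => exists_continuous_lt_entropyDual (h ν hν)
  obtain ⟨t, -, ht⟩ := hΓ.isCompact.elim_nhds_subcover
    (fun ν => {ν' | c < entropyDual (ν' : Measure X) μ (f ν)})
    (fun ν hν => (continuous_entropyDual (μ : Measure X) (f ν)).continuousAt.eventually
      (lt_mem_nhds (hf ν hν)))
  -- The extra 1 keeps the constant positive when the cover is empty.
  refine ⟨t.card + 1, Nat.succ_pos _, fun Ω _ P _ Y hY n => ?_⟩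
  calc P.real {ω | empirical n (fun i => Y i ω) ∈ Γ}
      ≤ P.real (⋃ ν ∈ t,
          {ω | c ≤ entropyDual (empirical n fun i => Y i ω : Measure X) μ (f ν)}) := by
        refine measureReal_mono (fun ω hω => ?_) (measure_ne_top _ _)
        obtain ⟨ν, hν, hlt : c < _⟩ := mem_iUnion₂.1 (ht hω)
        exact mem_iUnion₂.2 ⟨ν, hν, hlt.le⟩
    _ ≤ ∑ ν ∈ t, Real.exp (-c * n) :=
        (measureReal_biUnion_finset_le _ _).trans
          (Finset.sum_le_sum fun ν _ => hY.measureReal_le_entropyDual_le (f ν) c n)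
    _ ≤ (t.card + 1 : ℕ) * Real.exp (-c * n) := by
        rw [Finset.sum_const, nsmul_eq_mul]
        gcongr
        exact Nat.le_succ _

end Sanov

/-! ### Subsets and compactness in the Hausdorff upper topology -/

section UpperTopology

variable {X : Type*} [MetricSpace X]

theorem rho_eq_zero_of_subset {C D : HyperK X} (h : (C : Set X) ⊆ D) : rho C D = 0 := by
  refine le_antisymm (csSup_le (C.nonempty.image _) ?_) (rho_nonneg C D)
  rintro _ ⟨x, hx, rfl⟩
  exact (Metric.infDist_zero_of_mem (h hx)).le

/-- Since `ρ(C, D) = 0` for `C ⊆ D`, every ball around `D` contains all of its non-empty compact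
subsets. -/
theorem mem_of_isOpen_of_subset {U : Set (HyperK X)} (hU : IsOpen U) {C D : HyperK X}
    (h : (C : Set X) ⊆ D) (hD : D ∈ U) : C ∈ U := by
  obtain ⟨ε, hε, hball⟩ := hU D hD
  exact hball C (by rwa [rho_eq_zero_of_subset h])

/-- The family of the non-empty compact subsets of the members of a compact family is compact. -/
theorem isCompact_setOf_exists_subset {S : Set (HyperK X)} (hS : IsCompact S) :
    IsCompact {C : HyperK X | ∃ D ∈ S, (C : Set X) ⊆ D} := by
  refine isCompact_of_finite_subcover fun {ι} U hU hcov => ?_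
  obtain ⟨t, ht⟩ := hS.elim_finite_subcover U hU fun D hD => hcov ⟨D, hD, Subset.rfl⟩
  refine ⟨t, ?_⟩
  rintro C ⟨D, hD, hCD⟩
  obtain ⟨i, hi, hDi⟩ := mem_iUnion₂.1 (ht hD)
  exact mem_iUnion₂.2 ⟨i, hi, mem_of_isOpen_of_subset (hU i) hCD hDi⟩

end UpperTopology

/-! ### Continuity of the Fréchet mean and compact sublevel sets -/

section FrechetMean

open InformationTheory

variable {X : Type*} [MetricSpace X] [CompactSpace X] [MeasurableSpace X] [BorelSpace X]

/-- Replacing `h` by `h₀` costs at most `‖h - h₀‖`, uniformly over probability measures; for fixed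
`h₀` the claim is weak continuity. -/
theorem continuous_integral_prod_continuousMap :
    Continuous fun q : ProbabilityMeasure X × C(X, ℝ) => ∫ x, q.2 x ∂(q.1 : Measure X) := by
  refine continuous_iff_continuousAt.2 fun ⟨ν₀, h₀⟩ => ?_
  have hint : ∀ (ν : ProbabilityMeasure X) (h : C(X, ℝ)), Integrable h (ν : Measure X) :=
    fun ν h => integrable_of_abs_le h.continuous.measurable fun x => h.norm_coe_le_norm x
  have h1 : Tendsto (fun q : ProbabilityMeasure X × C(X, ℝ) => ∫ x, h₀ x ∂(q.1 : Measure X))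
      (𝓝 (ν₀, h₀)) (𝓝 (∫ x, h₀ x ∂(ν₀ : Measure X))) :=
    ((ProbabilityMeasure.continuous_integral_continuousMap h₀).comp continuous_fst).tendsto
      (ν₀, h₀)
  have h2 : Tendsto (fun q : ProbabilityMeasure X × C(X, ℝ) =>
      ∫ x, (q.2 - h₀) x ∂(q.1 : Measure X)) (𝓝 (ν₀, h₀)) (𝓝 0) := by
    have h3 : Tendsto (fun q : ProbabilityMeasure X × C(X, ℝ) => ‖q.2 - h₀‖)
        (𝓝 (ν₀, h₀)) (𝓝 0) := by
      have : Continuous fun q : ProbabilityMeasure X × C(X, ℝ) => ‖q.2 - h₀‖ := by fun_prop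
      simpa using this.tendsto (ν₀, h₀)
    refine squeeze_zero_norm (fun q => ?_) h3
    have := norm_integral_le_of_norm_le_const (μ := (q.1 : Measure X))
      (ae_of_all _ fun x => (q.2 - h₀).norm_coe_le_norm x)
    simpa using this
  have h4 := h1.add h2
  rw [add_zero] at h4
  refine h4.congr fun q => ?_
  rw [← integral_add (hint _ _) (hint _ _)]
  simp

theorem continuous_frechetFun_prod {p : ℝ} (hp : 1 ≤ p) :
    Continuous fun q : ProbabilityMeasure X × X => frechetFun p (q.1 : Measure X) q.2 := by
  let D : C(X × X, ℝ) := ⟨fun q => dist q.1 q.2 ^ p,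
    continuous_dist.rpow_const fun _ => Or.inr (zero_le_one.trans hp)⟩
  -- Currying makes `x ↦ d(x, ·)^p` continuous for the uniform norm.
  exact continuous_integral_prod_continuousMap.comp
    (continuous_fst.prodMk (D.curry.continuous.comp continuous_snd))

theorem mem_frechetMean {p : ℝ} {hp : 1 ≤ p} {ν : ProbabilityMeasure X} {x : X} :
    x ∈ (frechetMean p hp ν : Set X) ↔
      ∀ x', frechetFun p (ν : Measure X) x ≤ frechetFun p (ν : Measure X) x' := Iff.rfl

theorem isClosed_graph_frechetMean {p : ℝ} (hp : 1 ≤ p) :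
    IsClosed {q : ProbabilityMeasure X × X | q.2 ∈ (frechetMean p hp q.1 : Set X)} := by
  have : {q : ProbabilityMeasure X × X | q.2 ∈ (frechetMean p hp q.1 : Set X)} =
      ⋂ x', {q | frechetFun p (q.1 : Measure X) q.2 ≤ frechetFun p (q.1 : Measure X) x'} := by
    ext q
    rw [mem_iInter]
    exact mem_frechetMean (hp := hp)
  rw [this]
  exact isClosed_iInter fun x' => isClosed_le (continuous_frechetFun_prod hp)
    ((continuous_frechetFun_prod hp).comp (continuous_fst.prodMk continuous_const))

/-- The Fréchet mean is continuous from the weak topology to the Hausdorff upper topology. -/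
theorem continuous_frechetMean {p : ℝ} (hp : 1 ≤ p) :
    Continuous (frechetMean p hp : ProbabilityMeasure X → HyperK X) := by
  refine continuous_iff_continuousAt.2 fun ν₀ => tendsto_nhds.2 fun U hU hν₀ => ?_
  obtain ⟨ε, hε, hball⟩ := hU _ hν₀
  set C := frechetMean p hp ν₀
  have hfar : IsClosed {q : ProbabilityMeasure X × X | q.2 ∈ (frechetMean p hp q.1 : Set X) ∧
      ε / 2 ≤ Metric.infDist q.2 (C : Set X)} :=
    (isClosed_graph_frechetMean hp).inter (isClosed_le continuous_const
      ((Metric.continuous_infDist_pt _).comp continuous_snd))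
  -- Projection along the compact factor `X` is closed, so having no mean point at distance `ε / 2`
  -- or more from `C` is an open condition on `ν`.
  have hopen := (isClosedMap_fst_of_compactSpace _ hfar).isOpen_compl
  refine mem_of_superset (hopen.mem_nhds ?_) fun ν hν => hball _ ?_
  · rintro ⟨⟨ν, x⟩, ⟨hx, hdist⟩, rfl⟩
    rw [Metric.infDist_zero_of_mem hx] at hdist
    linarith
  -- The supremum is only known to be at most `ε / 2`; halving restores the strict inequality.
  · refine lt_of_le_of_lt (csSup_le ((frechetMean p hp ν).nonempty.image _) ?_) (half_lt_self hε)
    rintro _ ⟨x, hx, rfl⟩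
    by_contra! hlt
    exact hν ⟨(ν, x), ⟨hx, hlt.le⟩, rfl⟩

theorem rateFun_frechetMean_le {p : ℝ} (hp : 1 ≤ p) (μ ν : ProbabilityMeasure X) :
    rateFun p hp μ (frechetMean p hp ν) ≤ klDiv (ν : Measure X) (μ : Measure X) :=
  iInf₂_le ν Subset.rfl

/-- The infimum is attained: the competitors form a closed subset of a compact space, and the
entropy is lower semicontinuous. Finiteness of `α` rules out an empty set of competitors. -/
theorem rateFun_le_iff {p : ℝ} (hp : 1 ≤ p) (μ : ProbabilityMeasure X) (C : HyperK X)
    {α : ℝ≥0∞} (hα : α ≠ ∞) :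
    rateFun p hp μ C ≤ α ↔ ∃ ν : ProbabilityMeasure X,
      (C : Set X) ⊆ (frechetMean p hp ν : Set X) ∧ klDiv (ν : Measure X) (μ : Measure X) ≤ α := by
  refine ⟨fun h => ?_, fun ⟨ν, hC, hν⟩ => (iInf₂_le ν hC).trans hν⟩
  let S : Set (ProbabilityMeasure X) := {ν | (C : Set X) ⊆ (frechetMean p hp ν : Set X)}
  have hS : IsClosed S := by
    have : S = ⋂ x ∈ (C : Set X), {ν | x ∈ (frechetMean p hp ν : Set X)} := by
      ext ν
      simp [S, subset_def]
    rw [this]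
    exact isClosed_biInter fun x _ => (isClosed_graph_frechetMean hp).preimage
      (continuous_id.prodMk continuous_const)
  have hne : S.Nonempty := by
    by_contra hempty
    refine hα (top_le_iff.1 (le_trans ?_ h))
    refine le_iInf₂ fun ν hν => ?_
    exact (hempty ⟨ν, hν⟩).elim
  obtain ⟨ν, hν, hmin⟩ := ((lowerSemicontinuous_klDiv μ).lowerSemicontinuousOn S).exists_isMinOn
    hne hS.isCompact
  exact ⟨ν, hν, (le_iInf₂ fun ν' hν' => hmin hν').trans h⟩

theorem isCompact_setOf_rateFun_le {p : ℝ} (hp : 1 ≤ p) (μ : ProbabilityMeasure X) (α : ℝ≥0∞) :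
    IsCompact {C : HyperK X | rateFun p hp μ C ≤ α} := by
  rcases eq_or_ne α ∞ with rfl | hα
  -- For `α = ∞` the sublevel set is everything, that is, the subsets of the single compact set `X`.
  · have : Nonempty X := μ.nonempty
    let T : HyperK X := (⊤ : TopologicalSpace.NonemptyCompacts X)
    convert isCompact_setOf_exists_subset (isCompact_singleton (x := T)) using 1
    ext C
    have hC : (C : Set X) ⊆ T := fun x _ => mem_univ x
    simp [hC]
  · convert isCompact_setOf_exists_subset
      ((((lowerSemicontinuous_klDiv μ).isClosed_preimage α).isCompact).image
        (continuous_frechetMean hp)) using 1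
    ext C
    simp only [mem_ofPred_eq, rateFun_le_iff hp μ C hα, exists_mem_image]
    exact exists_congr fun ν => and_comm

end FrechetMean

/-! ### Large deviations and exponential concentration -/

section LargeDeviations

open InformationTheory

/-- An exponential bound `u n ≤ N e^{-cn}` gives `limsup (1/n) log u n ≤ -c`. -/
theorem limsup_log_le_neg {u : ℕ+ → ℝ≥0∞} {N c : ℝ} (hN : 0 < N)
    (h : ∀ n : ℕ+, u n ≤ ENNReal.ofReal (N * Real.exp (-c * n))) :
    limsup (fun n : ℕ+ => ((1 / (n : ℝ) : ℝ) : EReal) * ENNReal.log (u n)) atTop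
      ≤ ((-c : ℝ) : EReal) := by
  have hlim : Tendsto (fun n : ℕ+ => ((1 / (n : ℝ) * Real.log N - c : ℝ) : EReal)) atTop
      (𝓝 ((-c : ℝ) : EReal)) := by
    refine (continuous_coe_real_ereal.tendsto _).comp ?_
    have h0 : Tendsto (fun n : ℕ+ => 1 / ((n : ℕ) : ℝ)) atTop (𝓝 0) :=
      tendsto_one_div_atTop_nhds_zero_nat.comp tendsto_PNat_val_atTop_atTop
    simpa using (h0.mul_const (Real.log N)).sub_const c
  rw [← hlim.limsup_eq]
  refine limsup_le_limsup (Eventually.of_forall fun n => ?_)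
  have hn : (0 : ℝ) < n := by exact_mod_cast n.pos
  have hpos : 0 < N * Real.exp (-c * n) := mul_pos hN (Real.exp_pos _)
  calc ((1 / (n : ℝ) : ℝ) : EReal) * ENNReal.log (u n)
      ≤ ((1 / (n : ℝ) : ℝ) : EReal) * ((Real.log (N * Real.exp (-c * n)) : ℝ) : EReal) := by
        refine mul_le_mul_of_nonneg_left ?_ (EReal.coe_nonneg.2 (by positivity))
        rw [← ENNReal.log_ofReal_of_pos hpos]
        exact ENNReal.log_le_log (h n)
    _ = ((1 / (n : ℝ) * Real.log N - c : ℝ) : EReal) := by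
        rw [← EReal.coe_mul, Real.log_mul hN.ne' (Real.exp_pos _).ne', Real.log_exp]
        congr 1
        field_simp
        ring

variable {X : Type*} [MetricSpace X] [CompactSpace X] [MeasurableSpace X] [BorelSpace X]

/-- The large deviations upper bound for the Fréchet means of the empirical measures. -/
theorem IsIIDSample.limsup_log_frechetMean_mem_le {Ω : Type*} [MeasurableSpace Ω] {P : Measure Ω}
    [IsProbabilityMeasure P] {μ : ProbabilityMeasure X} {Y : ℕ → Ω → X} (hY : IsIIDSample P μ Y)
    {p : ℝ} (hp : 1 ≤ p) (A : Set (HyperK X)) :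
    limsup (fun n : ℕ+ => ((1 / (n : ℝ) : ℝ) : EReal) *
        ENNReal.log (P {ω | frechetMean p hp (empirical n fun i => Y i ω) ∈ A})) atTop
      ≤ -((⨅ C ∈ closure A, rateFun p hp μ C : ℝ≥0∞) : EReal) := by
  set r : ℝ≥0∞ := ⨅ C ∈ closure A, rateFun p hp μ C
  -- Probabilities are at most 1, so the limsup is at most 0; this settles negative levels `b`.
  have h0 := limsup_log_le_neg (N := 1) (c := 0)
    (u := fun n => P {ω | frechetMean p hp (empirical n fun i => Y i ω) ∈ A}) one_pos
    fun n => by simpa using prob_le_one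
  rw [EReal.le_neg]
  -- The infimum `r` may be infinite, so the bound is proved at each real level `b < r`.
  refine le_of_forall_lt_imp_le_of_dense fun b hb => ?_
  induction b with
  | bot => exact bot_le
  | top => exact (not_top_lt hb).elim
  | coe b =>
    rw [EReal.le_neg]
    rcases lt_or_ge b 0 with hb0 | hb0
    · refine h0.trans ?_
      rw [← EReal.coe_neg]
      exact EReal.coe_le_coe (by linarith)
    have hbr : ENNReal.ofReal b < r := by
      rwa [← EReal.coe_ennreal_lt_coe_ennreal_iff, EReal.coe_ennreal_ofReal, max_eq_left hb0]
    have hΓ : IsClosed (frechetMean p hp ⁻¹' closure A) :=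
      isClosed_closure.preimage (continuous_frechetMean hp)
    obtain ⟨N, hN, hbound⟩ := exists_measureReal_empirical_mem_le μ hΓ (c := b) fun ν hν =>
      hbr.trans_le ((iInf₂_le (frechetMean p hp ν) hν).trans (rateFun_frechetMean_le hp μ ν))
    rw [← EReal.coe_neg]
    refine limsup_log_le_neg (N := N) (by exact_mod_cast hN) fun n => ?_
    rw [ENNReal.le_ofReal_iff_toReal_le (measure_ne_top _ _) (by positivity)]
    refine (measureReal_mono (fun ω hω => ?_) (measure_ne_top _ _)).trans (hbound Ω P Y hY n)
    have hA : frechetMean p hp (empirical n fun i => Y i ω) ∈ A := hω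
    exact subset_closure hA

/-- The Fréchet means of the empirical measures concentrate exponentially fast. -/
theorem exists_measureReal_le_rho_frechetMean_le {p : ℝ} (hp : 1 ≤ p) (μ : ProbabilityMeasure X)
    {ε : ℝ} (hε : 0 < ε) : ∃ c₁ c₂ : ℝ, 0 < c₁ ∧ 0 < c₂ ∧
      ∀ (Ω : Type*) [MeasurableSpace Ω] (P : Measure Ω) [IsProbabilityMeasure P]
        (Y : ℕ → Ω → X), IsIIDSample P μ Y →
        ∀ n : ℕ+, P.real {ω | ε ≤ rho (frechetMean p hp (empirical n fun i => Y i ω))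
            (frechetMean p hp μ)} ≤ c₁ * Real.exp (-c₂ * n) := by
  let Γ : Set (ProbabilityMeasure X) := {ν | ε ≤ rho (frechetMean p hp ν) (frechetMean p hp μ)}
  have hΓ : IsClosed Γ := by
    have : Γ = (frechetMean p hp ⁻¹' {C | rho C (frechetMean p hp μ) < ε})ᶜ := by
      ext ν
      simp [Γ]
    rw [this]
    exact ((isOpen_rho_ball _ ε).preimage (continuous_frechetMean hp)).isClosed_compl
  have hpos : ∀ ν ∈ Γ, 0 < klDiv (ν : Measure X) (μ : Measure X) := fun ν hν => by
    refine pos_iff_ne_zero.2 fun h0 => ?_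
    have hνμ : (ν : Measure X) = μ := klDiv_eq_zero_iff.1 h0
    obtain rfl : ν = μ := Subtype.ext hνμ
    have hν' : ε ≤ rho (frechetMean p hp ν) (frechetMean p hp ν) := hν
    rw [rho_self] at hν'
    exact hν'.not_gt hε
  -- Sanov's bound needs a level strictly below the entropy on all of `Γ`; it is chosen below the
  -- attained positive minimum, or arbitrarily if `Γ` is empty.
  obtain ⟨c, hc0, hc⟩ : ∃ c : ℝ, 0 < c ∧
      ∀ ν ∈ Γ, ENNReal.ofReal c < klDiv (ν : Measure X) (μ : Measure X) := by
    rcases Γ.eq_empty_or_nonempty with hempty | hne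
    · exact ⟨1, one_pos, by simp [hempty]⟩
    · obtain ⟨ν, hν, hmin⟩ :=
        ((lowerSemicontinuous_klDiv μ).lowerSemicontinuousOn Γ).exists_isMinOn hne hΓ.isCompact
      obtain ⟨c, -, hc⟩ := ENNReal.lt_iff_exists_real_btwn.1 (hpos ν hν)
      exact ⟨c, ENNReal.ofReal_pos.1 hc.1, fun ν' hν' => hc.2.trans_le (hmin hν')⟩
  obtain ⟨N, hN, hbound⟩ := exists_measureReal_empirical_mem_le μ hΓ hc
  exact ⟨N, c, by exact_mod_cast hN, hc0, hbound⟩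

end LargeDeviations

end FrechetLDP

theorem mainTheorem6 {X : Type*} [MetricSpace X] [CompactSpace X] [MeasurableSpace X]
    [BorelSpace X] (p : ℝ) (hp : 1 ≤ p) (μ : ProbabilityMeasure X) :
    -- compact sublevel sets in the Hausdorff upper topology
    (∀ α : ℝ≥0∞, IsCompact {C : HyperK X | rateFun p hp μ C ≤ α}) ∧
    -- the large deviations upper bound
    (∀ (Ω : Type*) [MeasurableSpace Ω] (P : Measure Ω) [IsProbabilityMeasure P]
        (Y : ℕ → Ω → X), IsIIDSample P μ Y →
      ∀ A : Set (HyperK X), MeasurableSet[borel (HyperK X)] A →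
        limsup (fun n : ℕ+ => ((1 / (n : ℝ) : ℝ) : EReal) *
            ENNReal.log (P {ω | frechetMean p hp (empirical n fun i => Y i ω) ∈ A})) atTop
          ≤ -((⨅ C ∈ closure A, rateFun p hp μ C : ℝ≥0∞) : EReal)) ∧
    -- exponential decay, with constants that depend on `X`, `μ`, `p` and `ε` only
    (∀ ε : ℝ, 0 < ε → ∃ c₁ c₂ : ℝ, 0 < c₁ ∧ 0 < c₂ ∧
      ∀ (Ω : Type*) [MeasurableSpace Ω] (P : Measure Ω) [IsProbabilityMeasure P]
        (Y : ℕ → Ω → X), IsIIDSample P μ Y →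
        ∀ n : ℕ+, P.real {ω | ε ≤ rho (frechetMean p hp (empirical n fun i => Y i ω))
            (frechetMean p hp μ)} ≤ c₁ * Real.exp (-c₂ * n)) :=
  ⟨isCompact_setOf_rateFun_le hp μ,
    fun _ _ _ _ _ hY A _ => hY.limsup_log_frechetMean_mem_le hp A,
    fun _ hε => exists_measureReal_le_rho_frechetMean_le hp μ hε⟩
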